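/- **Definitions.** Let $\aleph_0$ be the skeleton of the category of finite sets and all functions, with objects the natural numbers. A *Lawvere theory* is a category $L$ with small hom-sets, together with an identity-on-objects functor $I\colon\aleph_0^{\mathrm{op}}\to L$ that preserves finite products (so $L$ has finite products, strictly preserved by $I$). A *map of Lawvere theories* $L\to L'$ is a finite-product-preserving functor $F\colon L\to L'$ with $F\circ I=I'$. These form a category $\mathbf{Law}$. For a category $\mathcal B$, a *$\mathcal B$-indexed Lawvere theory* is a functor $\mathbb L\colon\mathcal B\to\mathbf{Law}$, $b\mapsto\mathbb L_b$, $u\mapsto\mathbb L_u$. The category $\mathrm{Mod}(\mathbb L,\mathbf{Set})$ is defined as follows. An object $M$ consists of a finite-product-preserving functor $M_b\colon\mathbb L_b\to\mathbf{Set}$ for each object $b$ of $\mathcal B$, and a natural transformation $M_u\colon M_b\Rightarrow M_{b'}\circ\mathbb L_u$ for each morphism $u\colon b\to b'$ of $\mathcal B$, such that $M_{\mathrm{id}_b}=\mathrm{id}_{M_b}$ and, for $u\colon b\to b'$ and $u'\colon b'\to b''$, $M_{u'\circ u}$ is the composite of $M_u$ with the whiskering of $M_{u'}$ by $\mathbb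 L_u$, i.e. $(M_{u'\circ u})_x=(M_{u'})_{\mathbb L_u x}\circ(M_u)_x$. A morphism $\varphi\colon M\to M'$ is a family of natural transformations $\varphi_b\colon M_b\Rightarrow M'_b$ such that $(M'_u)_x\circ(\varphi_b)_x=(\varphi_{b'})_{\mathbb L_u x}\circ(M_u)_x$ for every $u\colon b\to b'$ in $\mathcal B$ and every object $x$ of $\mathbb L_b$. Every Lawvere theory $L$ has an associated finitary monad $\iota L=T_L$ on $\mathbf{Set}$, with underlying functor the coend $T_LX=\int^{n\in\aleph_0}L(n,1)\times X^n$, unit $x\mapsto[1,\mathrm{id}_1,x]$ and multiplication $[n,t,([k,s_i,y])_{i<n}]\mapsto[k,t\circ\langle s_i\rangle_{i<n},y]$ (finitely many elements can always be written over a common pair $(k,y)$); a map $G\colon L\to L'$ of Lawvere theories induces the monad morphism $T_L\Rightarrow T_{L'}$, $[n,t,x]\mapsto[n,Gt,x]$. Hence $\mathbb L$ determines a $\mathcal B$-indexed monad $\iota\mathbb L$ on $\mathbf{Set}$, i.e. monads $T_b=\iota(\mathbb L_b)$ and monad morphisms $T_u\colon T_b\Rightarrow T_{b'}$ for $u\colon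 b\to b'$, functorially in $u$. The Eilenberg–Moore category $\mathbf{Set}^{\iota\mathbb L}$ has as objects the pairs $(b,\chi)$ of an object $b$ of $\mathcal B$ and a $T_b$-algebra $\chi\colon T_bc\to c$, and as morphisms $(b,\chi)\to(b',\chi')$ the pairs $(u,h)$ of a morphism $u\colon b\to b'$ of $\mathcal B$ and a function $h\colon c\to c'$ with $h\circ\chi=\chi'\circ T_{u,c'}\circ T_bh$; the functor $\pi_0\colon\mathbf{Set}^{\iota\mathbb L}\to\mathcal B$ is $(b,\chi)\mapsto b$, $(u,h)\mapsto u$. For a functor $p\colon\mathcal E\to\mathcal B$, the value at $p$ of the dependent-product 2-functor $\prod_{\mathcal B}=\mathbf{Cat}/\mathcal B\,(\mathrm{id}_{\mathcal B},-)\colon\mathbf{Cat}/\mathcal B\to\mathbf{Cat}$ is the category $\prod_{\mathcal B}(p\colon\mathcal E\to\mathcal B)$ whose objects are the sections of $p$, i.e. functors $s\colon\mathcal B\to\mathcal E$ with $p\circ s=\mathrm{id}_{\mathcal B}$, and whose morphisms $s\to s'$ are the vertical natural transformations, i.e. natural transformations $\psi\colon s\Rightarrow s'$ with $p\ast\psi=\mathrm{id}_{\mathrm{id}_{\mathcal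 B}}$. **Theorem.** Let $\mathcal B$ be a category and $\mathbb L$ a $\mathcal B$-indexed Lawvere theory. Then there is an equivalence of categories $$\mathrm{Mod}(\mathbb L,\mathbf{Set})\;\simeq\;\textstyle\prod_{\mathcal B}\bigl(\pi_0\colon\mathbf{Set}^{\iota\mathbb L}\to\mathcal B\bigr).$$ -/

import Mathlib

open CategoryTheory CategoryTheory.Limits Opposite

universe u v w v₁ u₁ v₂ u₂

namespace IndexedLawvere

/-! ### Lawvere theories -/

/-- `ℵ₀`, the skeleton of the category of finite sets and all functions. -/
abbrev Aleph0 : Type := FintypeCat.Skeleton.{0}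

/-- The finite set `{0, …, n - 1}` underlying the object `n` of `ℵ₀`; a morphism `m ⟶ n` of `ℵ₀`
is a function `Pos m → Pos n`. -/
abbrev Pos (n : Aleph0) : Type := ULift.{0} (Fin n.len)

/-- The one-element object of `ℵ₀`. -/
abbrev one : Aleph0 := FintypeCat.Skeleton.mk 1

/-- A function between the underlying sets, as a morphism of `ℵ₀`. -/
abbrev ofFun {m n : Aleph0} (f : Pos m → Pos n) : m ⟶ n := f

/-- A category with the same objects as `ℵ₀`, together with an identity-on-objects functor from
`ℵ₀ᵒᵖ` to it. -/
structure PreTheory : Type (u + 1) where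
  /-- the morphisms of the category -/
  Hom : Aleph0 → Aleph0 → Type u
  id (n : Aleph0) : Hom n n
  comp {l m n : Aleph0} : Hom l m → Hom m n → Hom l n
  id_comp {m n : Aleph0} (f : Hom m n) : comp (id m) f = f
  comp_id {m n : Aleph0} (f : Hom m n) : comp f (id n) = f
  assoc {k l m n : Aleph0} (f : Hom k l) (g : Hom l m) (h : Hom m n) :
    comp (comp f g) h = comp f (comp g h)
  /-- the action on morphisms of the functor from `ℵ₀ᵒᵖ` -/
  incl {m n : Aleph0} : (m ⟶ n) → Hom n m
  incl_id (n : Aleph0) : incl (𝟙 n) = id n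
  incl_comp {l m n : Aleph0} (f : l ⟶ m) (g : m ⟶ n) : incl (f ≫ g) = comp (incl g) (incl f)

namespace PreTheory

/-- The objects of the category `L`: a copy of the objects of `ℵ₀`. -/
@[ext]
structure Obj (L : PreTheory.{u}) : Type where
  arity : Aleph0

instance (L : PreTheory.{u}) : Category.{u} L.Obj where
  Hom X Y := L.Hom X.arity Y.arity
  id X := L.id X.arity
  comp := L.comp
  id_comp := L.id_comp
  comp_id := L.comp_id
  assoc := L.assoc

/-- The identity-on-objects functor `I : ℵ₀ᵒᵖ ⥤ L`. -/
def I (L : PreTheory.{u}) : Aleph0ᵒᵖ ⥤ L.Obj where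
  obj n := ⟨n.unop⟩
  map f := L.incl f.unop
  map_id n := L.incl_id n.unop
  map_comp f g := L.incl_comp g.unop f.unop

end PreTheory

/-- A Lawvere theory: a category `L` and an identity-on-objects functor `I : ℵ₀ᵒᵖ ⥤ L` which
preserves finite products. (As `ℵ₀ᵒᵖ` has finite products, so has `L`, and `I` preserves them
strictly if those of `L` are chosen to be the images under `I` of those of `ℵ₀ᵒᵖ`.) -/
structure LawvereTheory : Type (u + 1) extends PreTheory.{u} where
  preserves : PreservesFiniteProducts toPreTheory.I

namespace LawvereTheory

/-- An identity-on-objects functor from `L` to `L'` that commutes with the functors from `ℵ₀ᵒᵖ`. -/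
@[ext]
structure PreHom (L L' : LawvereTheory.{u}) : Type u where
  map {m n : Aleph0} : L.Hom m n → L'.Hom m n
  map_id (n : Aleph0) : map (L.id n) = L'.id n
  map_comp {l m n : Aleph0} (f : L.Hom l m) (g : L.Hom m n) :
    map (L.comp f g) = L'.comp (map f) (map g)
  map_incl {m n : Aleph0} (f : m ⟶ n) : map (L.incl f) = L'.incl f

/-- The underlying functor of a `PreHom`. -/
def PreHom.toFunctor {L L' : LawvereTheory.{u}} (G : PreHom L L') : L.Obj ⥤ L'.Obj where
  obj X := ⟨X.arity⟩
  map f := G.map f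
  map_id X := G.map_id X.arity
  map_comp f g := G.map_comp f g

/-- A map of Lawvere theories: a finite product preserving functor that commutes with the functors
from `ℵ₀ᵒᵖ`. -/
@[ext]
structure TheoryMap (L L' : LawvereTheory.{u}) : Type u extends PreHom L L' where
  preserves : PreservesFiniteProducts toPreHom.toFunctor

/-- `Law`, the category of Lawvere theories. -/
instance : Category.{u} LawvereTheory.{u} where
  Hom := TheoryMap
  id L :=
    { map := fun f => f
      map_id := fun _ => rfl
      map_comp := fun _ _ => rfl
      map_incl := fun _ => rfl
      preserves := (inferInstance : PreservesFiniteProducts (𝟭 L.Obj)) }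
  comp {L L' L''} G H :=
    { map := fun f => H.map (G.map f)
      map_id := fun n => by rw [G.map_id, H.map_id]
      map_comp := fun f g => by rw [G.map_comp, H.map_comp]
      map_incl := fun f => by rw [G.map_incl, H.map_incl]
      preserves :=
        haveI := G.preserves
        haveI := H.preserves
        (inferInstance : PreservesFiniteProducts (G.toFunctor ⋙ H.toFunctor)) }

/-- The functor between the underlying categories given by a map of Lawvere theories. -/
def functorOf {L L' : LawvereTheory.{u}} (G : L ⟶ L') : L.Obj ⥤ L'.Obj :=
  PreHom.toFunctor (TheoryMap.toPreHom G)

theorem I_comp_functorOf {L L' : LawvereTheory.{u}} (G : L ⟶ L') :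
    L.I ⋙ functorOf G = L'.I :=
  CategoryTheory.Functor.ext (fun _ => rfl) (fun m n f => by
    have h : (L.I ⋙ functorOf G).map f = L'.I.map f := (TheoryMap.toPreHom G).map_incl f.unop
    rw [h]
    exact ((Category.id_comp _).trans (Category.comp_id _)).symm)

end LawvereTheory

/-! ### Models of indexed Lawvere theories -/

section Models

variable {B : Type w} [Category.{v} B]

/-- A model of the `B`-indexed Lawvere theory `L` in a category `C` (with finite products). -/
structure Model (L : B ⥤ LawvereTheory.{u}) (C : Type u₁) [Category.{v₁} C] where
  /-- the models `M_b` of the theories `L_b` -/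
  obj (b : B) : (L.obj b).Obj ⥤ C
  preserves (b : B) : PreservesFiniteProducts (obj b)
  /-- the natural transformations `M_u : M_b ⟹ M_b' ∘ L_u` -/
  map {b b' : B} (u : b ⟶ b') : obj b ⟶ LawvereTheory.functorOf (L.map u) ⋙ obj b'
  map_id (b : B) (X : (L.obj b).Obj) : (map (𝟙 b)).app X = 𝟙 ((obj b).obj X)
  map_comp {b b' b'' : B} (u : b ⟶ b') (u' : b' ⟶ b'') (X : (L.obj b).Obj) :
    (map (u ≫ u')).app X =
      (map u).app X ≫ (map u').app ((LawvereTheory.functorOf (L.map u)).obj X)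

variable {L : B ⥤ LawvereTheory.{u}} {C : Type u₁} [Category.{v₁} C]

/-- A morphism of models of an indexed Lawvere theory. -/
@[ext]
structure Model.Hom (M M' : Model L C) where
  app (b : B) : M.obj b ⟶ M'.obj b
  comm {b b' : B} (u : b ⟶ b') :
    app b ≫ M'.map u =
      M.map u ≫ Functor.whiskerLeft (LawvereTheory.functorOf (L.map u)) (app b')

/-- The category `Mod(L, C)` of models of an indexed Lawvere theory. -/
instance : Category (Model L C) where
  Hom := Model.Hom
  id M :=
    { app := fun b => 𝟙 (M.obj b)
      comm := fun u => by simp }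
  comp φ ψ :=
    { app := fun b => φ.app b ≫ ψ.app b
      comm := fun u => by
        rw [Category.assoc, ψ.comm, ← Category.assoc, φ.comm, Functor.whiskerLeft_comp,
          Category.assoc] }
  id_comp φ := Model.Hom.ext (funext fun b => Category.id_comp (φ.app b))
  comp_id φ := Model.Hom.ext (funext fun b => Category.comp_id (φ.app b))
  assoc φ ψ χ := Model.Hom.ext (funext fun b => Category.assoc (φ.app b) (ψ.app b) (χ.app b))

end Models

/-! ### The finitary monad of a Lawvere theory

`T_L X` is the coend `∫^{n ∈ ℵ₀} L(n, 1) × X ^ n`. -/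

namespace LawvereTheory

variable (L : LawvereTheory.{u})

/-- Elements of the disjoint union of the sets `L(n, 1) × X ^ n`. -/
structure Pre (X : Type u) : Type u where
  n : Aleph0
  opn : L.Hom n one
  arg : Pos n → X

variable {L} in
/-- The relation that defines the coend: `(t ∘ I(f), x) ∼ (t, x ∘ f)` for `f : m ⟶ n`. -/
inductive Pre.Rel {X : Type u} : L.Pre X → L.Pre X → Prop
  | mk {m n : Aleph0} (f : m ⟶ n) (t : L.Hom m one) (x : Pos n → X) :
      Pre.Rel ⟨n, L.comp (L.incl f) t, x⟩ ⟨m, t, fun i => x (f i)⟩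

/-- The coend `∫^{n ∈ ℵ₀} L(n, 1) × X ^ n`. -/
def Free (X : Type u) : Type u := Quot (Pre.Rel (L := L) (X := X))

namespace Free

variable {L} {X Y Z : Type u}

/-- The class `[n, t, x]` of `(n, t, x)`. -/
def mk (n : Aleph0) (t : L.Hom n one) (x : Pos n → X) : L.Free X := Quot.mk _ ⟨n, t, x⟩

@[elab_as_elim]
theorem ind {p : L.Free X → Prop} (a : L.Free X) (h : ∀ n t x, p (mk n t x)) : p a :=
  Quot.ind (fun b => h b.n b.opn b.arg) a

theorem mk_incl {m n : Aleph0} (f : m ⟶ n) (t : L.Hom m one) (x : Pos n → X) :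
    mk n (L.comp (L.incl f) t) x = mk m t (fun i => x (f i)) :=
  Quot.sound (.mk f t x)

end Free

/-- The `i`-th projection `n ⟶ 1`. -/
def proj {n : Aleph0} (i : Pos n) : L.Hom n one := L.incl (ofFun fun _ => i)

theorem incl_proj {m n : Aleph0} (f : m ⟶ n) (i : Pos m) :
    L.comp (L.incl f) (L.proj i) = L.proj (f i) :=
  (L.incl_comp (ofFun fun _ => i) f).symm

/-- In `ℵ₀`, the object `n` is the `n`-fold copower of `1`. -/
def isColimitPos (n : Aleph0) :
    IsColimit (Cofan.mk (f := fun _ : Pos n => one) n (fun i => ofFun fun _ => i)) :=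
  Cofan.IsColimit.mk _ (fun s => ofFun fun i => s.inj i ⟨(0 : Fin 1)⟩)
    (fun s i => by
      funext x
      have hx : x = ⟨(0 : Fin 1)⟩ := by
        obtain ⟨x⟩ := x
        exact congrArg _ (Subsingleton.elim (α := Fin 1) x 0)
      subst hx
      rfl)
    (fun s m hm => by
      funext i
      exact congrFun (hm i) ⟨(0 : Fin 1)⟩)

theorem exists_tuple {k n : Aleph0} (s : Pos n → L.Hom k one) :
    ∃! t : L.Hom k n, ∀ i, L.comp t (L.proj i) = s i := by
  have := L.preserves
  have hl : IsLimit (Fan.mk (f := fun _ : Pos n => (⟨one⟩ : L.Obj)) (⟨n⟩ : L.Obj)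
      (fun i => (L.proj i : L.Hom n one))) :=
    isLimitFanMkObjOfIsLimit L.I (fun _ : Pos n => op one) (fun i => (ofFun fun _ => i).op)
      (Cofan.IsColimit.op (isColimitPos n))
  refine ⟨Fan.IsLimit.lift (A := (⟨k⟩ : L.Obj)) hl s, fun i => Fan.IsLimit.fac hl _ i, ?_⟩
  intro t ht
  exact Fan.IsLimit.hom_ext (A := (⟨k⟩ : L.Obj)) hl t _ fun i =>
    (ht i).trans (Fan.IsLimit.fac (A := (⟨k⟩ : L.Obj)) hl s i).symm

/-- The morphism `k ⟶ n` with the given components. -/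
noncomputable def tuple {k n : Aleph0} (s : Pos n → L.Hom k one) : L.Hom k n :=
  (L.exists_tuple s).choose

theorem tuple_proj {k n : Aleph0} (s : Pos n → L.Hom k one) (i : Pos n) :
    L.comp (L.tuple s) (L.proj i) = s i :=
  (L.exists_tuple s).choose_spec.1 i

theorem hom_ext {k n : Aleph0} {t t' : L.Hom k n}
    (h : ∀ i, L.comp t (L.proj i) = L.comp t' (L.proj i)) : t = t' :=
  (L.exists_tuple fun i => L.comp t' (L.proj i)).unique h fun _ => rfl

theorem comp_tuple {j k n : Aleph0} (r : L.Hom j k) (s : Pos n → L.Hom k one) :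
    L.comp r (L.tuple s) = L.tuple fun i => L.comp r (s i) :=
  L.hom_ext fun i => by rw [L.assoc, tuple_proj, tuple_proj]

theorem tuple_proj_eq_id (n : Aleph0) : L.tuple (fun i : Pos n => L.proj i) = L.id n :=
  L.hom_ext fun i => by rw [tuple_proj, L.id_comp]

theorem proj_one (i : Pos one) : L.proj i = L.id one := by
  rw [← L.incl_id]
  refine congrArg L.incl ?_
  funext x
  obtain ⟨i⟩ := i
  obtain ⟨x⟩ := x
  exact congrArg ULift.up (Subsingleton.elim (α := Fin 1) i x)

theorem tuple_one (k : Aleph0) (s : L.Hom k one) : L.tuple (fun _ : Pos one => s) = s := by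
  have h := L.tuple_proj (fun _ : Pos one => s) ⟨(0 : Fin 1)⟩
  rwa [proj_one, L.comp_id] at h

/-- Finitely many finite families in `X` factor through a common injective finite family. -/
theorem exists_cover {X : Type u} {ι : Type} [Finite ι] (k : ι → Aleph0)
    (z : ∀ i, Pos (k i) → X) :
    ∃ (n : Aleph0) (y : Pos n → X) (h : ∀ i, k i ⟶ n),
      Function.Injective y ∧ ∀ i x, y (h i x) = z i x := by
  let S : Set X := Set.range fun p : Σ i, Pos (k i) => z p.1 p.2
  have : Finite S := Set.finite_range _
  obtain ⟨n, ⟨e⟩⟩ := Finite.exists_equiv_fin S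
  refine ⟨FintypeCat.Skeleton.mk n, fun x => (e.symm x.down).1,
    fun i => ofFun fun x => ⟨e ⟨z i x, ⟨i, x⟩, rfl⟩⟩, ?_, ?_⟩
  · intro x x' hx
    exact ULift.down_injective (e.symm.injective (Subtype.ext hx))
  · intro i x
    exact congrArg Subtype.val (e.symm_apply_apply (⟨z i x, ⟨i, x⟩, rfl⟩ : S))

namespace Free

variable {L} {X Y Z : Type u}

theorem mk_eq_iff {m n : Aleph0} {s : L.Hom m one} {t : L.Hom n one} {x : Pos m → X}
    {y : Pos n → X} :
    mk m s x = mk n t y ↔ ∃ (k : Aleph0) (z : Pos k → X) (f : m ⟶ k) (g : n ⟶ k),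
      (∀ i, z (f i) = x i) ∧ (∀ i, z (g i) = y i) ∧
        L.comp (L.incl f) s = L.comp (L.incl g) t := by
  constructor
  · intro h
    let R : L.Pre X → L.Pre X → Prop := fun a b =>
      ∃ (k : Aleph0) (z : Pos k → X) (f : a.n ⟶ k) (g : b.n ⟶ k),
        (∀ i, z (f i) = a.arg i) ∧ (∀ i, z (g i) = b.arg i) ∧
          L.comp (L.incl f) a.opn = L.comp (L.incl g) b.opn
    suffices H : ∀ a b, Relation.EqvGen Pre.Rel a b → R a b from
      H ⟨m, s, x⟩ ⟨n, t, y⟩ (Quot.eqvGen_exact h)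
    intro a b hab
    induction hab with
    | rel a b h =>
      cases h with
      | mk f op arg =>
        refine ⟨_, arg, 𝟙 _, f, fun _ => rfl, fun _ => rfl, ?_⟩
        rw [L.incl_id, L.id_comp]
    | refl a => exact ⟨a.n, a.arg, 𝟙 _, 𝟙 _, fun _ => rfl, fun _ => rfl, rfl⟩
    | symm a b _ ih =>
      obtain ⟨k, z, f, g, hf, hg, h⟩ := ih
      exact ⟨k, z, g, f, hg, hf, h.symm⟩
    | trans a b c _ _ ih ih' =>
      obtain ⟨k, z, f, g, hf, hg, h⟩ := ih
      obtain ⟨k', z', f', g', hf', hg', h'⟩ := ih'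
      obtain ⟨K, Z, j, hZ, hj⟩ := exists_cover (X := X) (ι := Bool)
        (fun b => cond b k k') (fun b => match b with | true => z | false => z')
      have e : g ≫ j true = f' ≫ j false := by
        funext i
        apply hZ
        exact (hj true (g i)).trans ((hg i).trans ((hf' i).symm.trans (hj false (f' i)).symm))
      refine ⟨K, Z, f ≫ j true, g' ≫ j false, fun i => (hj true (f i)).trans (hf i),
        fun i => (hj false (g' i)).trans (hg' i), ?_⟩
      rw [L.incl_comp, L.incl_comp, L.assoc, L.assoc, h, ← h', ← L.assoc, ← L.assoc,
        ← L.incl_comp, ← L.incl_comp, e]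
  · rintro ⟨k, z, f, g, hf, hg, h⟩
    have h1 := mk_incl f s z
    have h2 := mk_incl g t z
    rw [show (fun i => z (f i)) = x from funext hf] at h1
    rw [show (fun i => z (g i)) = y from funext hg] at h2
    rw [← h1, ← h2, h]

/-- Finitely many elements can be written over a common context. -/
theorem exists_common {n : Aleph0} (a : Pos n → L.Free X) :
    ∃ (k : Aleph0) (y : Pos k → X) (s : Pos n → L.Hom k one), ∀ i, a i = mk k (s i) y := by
  have h : ∀ i, ∃ (k : Aleph0) (s : L.Hom k one) (x : Pos k → X), a i = mk k s x := fun i =>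
    ind (a i) fun k s x => ⟨k, s, x, rfl⟩
  choose k s x hx using h
  obtain ⟨K, Z, j, -, hj⟩ := exists_cover k x
  refine ⟨K, Z, fun i => L.comp (L.incl (j i)) (s i), fun i => ?_⟩
  rw [mk_incl, hx i]
  exact congrArg _ (funext fun y => (hj i y).symm)

/-- The operation of arity `n` on `T_L X` given by `t`:
`([k, s_i, y])_i ↦ [k, t ∘ (s_i)_i, y]`. -/
noncomputable def act {n : Aleph0} (t : L.Hom n one) (a : Pos n → L.Free X) : L.Free X :=
  mk (exists_common a).choose
    (L.comp (L.tuple (exists_common a).choose_spec.choose_spec.choose) t)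
    (exists_common a).choose_spec.choose

theorem mk_tuple_eq {n k k' : Aleph0} (t : L.Hom n one) (s : Pos n → L.Hom k one)
    (s' : Pos n → L.Hom k' one) (y : Pos k → X) (y' : Pos k' → X)
    (h : ∀ i, mk k (s i) y = mk k' (s' i) y') :
    mk k (L.comp (L.tuple s) t) y = mk k' (L.comp (L.tuple s') t) y' := by
  have h' := fun i => mk_eq_iff.1 (h i)
  choose K z f g hf hg hfg using h'
  obtain ⟨N, Z, j, hZ, hj⟩ := exists_cover (X := X) (ι := Option (Option (Pos n)))
    (fun o => match o with | none => k | some none => k' | some (some i) => K i)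
    (fun o => match o with | none => y | some none => y' | some (some i) => z i)
  let p : k ⟶ N := j none
  let q : k' ⟶ N := j (some none)
  have hp : ∀ i, f i ≫ j (some (some i)) = p := fun i => by
    funext x
    exact hZ ((hj (some (some i)) (f i x)).trans ((hf i x).trans (hj none x).symm))
  have hq : ∀ i, g i ≫ j (some (some i)) = q := fun i => by
    funext x
    exact hZ ((hj (some (some i)) (g i x)).trans ((hg i x).trans (hj (some none) x).symm))
  refine mk_eq_iff.2 ⟨N, Z, p, q, hj none, hj (some none), ?_⟩
  rw [← L.assoc, ← L.assoc, comp_tuple, comp_tuple]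
  congr 2
  funext i
  have e := congrArg (L.comp (L.incl (j (some (some i))))) (hfg i)
  rw [← L.assoc, ← L.assoc, ← L.incl_comp, ← L.incl_comp] at e
  rw [← hp i, ← hq i]
  exact e

theorem act_eq {n k : Aleph0} (t : L.Hom n one) (a : Pos n → L.Free X)
    (s : Pos n → L.Hom k one) (y : Pos k → X) (h : ∀ i, a i = mk k (s i) y) :
    act t a = mk k (L.comp (L.tuple s) t) y :=
  mk_tuple_eq _ _ _ _ _ fun i =>
    ((exists_common a).choose_spec.choose_spec.choose_spec i).symm.trans (h i)

theorem act_incl {m n : Aleph0} (f : m ⟶ n) (t : L.Hom m one) (a : Pos n → L.Free X) :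
    act (L.comp (L.incl f) t) a = act t fun i => a (f i) := by
  obtain ⟨k, y, s, h⟩ := exists_common a
  rw [act_eq _ _ s y h, act_eq t (fun i => a (f i)) (fun i => s (f i)) y fun i => h (f i),
    ← L.assoc]
  congr 2
  exact L.hom_ext fun i => by rw [L.assoc, incl_proj, tuple_proj, tuple_proj]

/-- The functorial action of `T_L`: `[n, t, x] ↦ [n, t, φ ∘ x]`. -/
def map (φ : X → Y) : L.Free X → L.Free Y :=
  Quot.lift (fun a => mk a.n a.opn fun i => φ (a.arg i)) (by
    rintro _ _ ⟨f, op, arg⟩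
    exact mk_incl f op fun i => φ (arg i))

/-- The unit of `T_L`: `x ↦ [1, id, x]`. -/
def unit (x : X) : L.Free X := mk one (L.id one) fun _ => x

/-- The multiplication of `T_L`: `[n, t, ([k, s_i, y])_i] ↦ [k, t ∘ (s_i)_i, y]`. -/
noncomputable def mult : L.Free (L.Free X) → L.Free X :=
  Quot.lift (fun a => act a.opn a.arg) (by
    rintro _ _ ⟨f, op, arg⟩
    exact act_incl f op arg)

theorem map_mk (φ : X → Y) (n : Aleph0) (t : L.Hom n one) (x : Pos n → X) :
    map φ (mk n t x) = mk n t fun i => φ (x i) := rfl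

theorem mult_mk (n : Aleph0) (t : L.Hom n one) (a : Pos n → L.Free X) :
    mult (mk n t a) = act t a := rfl

theorem map_act (φ : X → Y) {n : Aleph0} (t : L.Hom n one) (a : Pos n → L.Free X) :
    map φ (act t a) = act t fun i => map φ (a i) := by
  obtain ⟨k, y, s, h⟩ := exists_common a
  rw [act_eq _ _ s y h, map_mk, act_eq t (fun i => map φ (a i)) s (fun i => φ (y i))]
  intro i
  rw [h i, map_mk]

theorem mult_assoc (z : L.Free (L.Free (L.Free X))) : mult (map mult z) = mult (mult z) := by
  induction z using Free.ind with | h n t a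
  obtain ⟨k, b, s, h⟩ := exists_common a
  obtain ⟨l, x, r, h'⟩ := exists_common b
  rw [map_mk, mult_mk, mult_mk, act_eq t a s b h, mult_mk, act_eq _ b r x h',
    act_eq t _ (fun i => L.comp (L.tuple r) (s i)) x, ← comp_tuple, L.assoc]
  intro i
  rw [h i, mult_mk, act_eq _ b r x h']

theorem mult_unit (a : L.Free X) : mult (unit a) = a := by
  induction a using Free.ind with | h n t x
  rw [unit, mult_mk, act_eq _ _ (fun _ => t) x fun _ => rfl, tuple_one, L.comp_id]

theorem mult_map_unit (a : L.Free X) : mult (map unit a) = a := by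
  induction a using Free.ind with | h n t x
  rw [map_mk, mult_mk, act_eq t _ (fun i => L.proj i) x, tuple_proj_eq_id, L.id_comp]
  intro i
  have h := mk_incl (ofFun fun _ : Pos one => i) (L.id one) x
  rw [L.comp_id] at h
  exact h.symm

/-- The map `T_L X → T_L' X`, `[n, t, x] ↦ [n, G t, x]`, given by a map `G` of Lawvere theories. -/
def change {L' : LawvereTheory.{u}} (G : PreHom L L') : L.Free X → L'.Free X :=
  Quot.lift (fun a => mk a.n (G.map a.opn) a.arg) (by
    rintro _ _ ⟨f, op, arg⟩
    have h := mk_incl f (G.map op) arg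
    rw [← G.map_incl, ← G.map_comp] at h
    exact h)

theorem change_mk {L' : LawvereTheory.{u}} (G : PreHom L L') (n : Aleph0) (t : L.Hom n one)
    (x : Pos n → X) : change G (mk n t x) = mk n (G.map t) x := rfl

theorem change_mult {L' : LawvereTheory.{u}} (G : PreHom L L') (z : L.Free (L.Free X)) :
    change G (mult z) = mult (change G (map (change G) z)) := by
  induction z using Free.ind with | h n t a
  obtain ⟨k, y, s, h⟩ := exists_common a
  rw [mult_mk, act_eq t a s y h, map_mk, change_mk, change_mk, mult_mk,
    act_eq (G.map t) _ (fun i => G.map (s i)) y, G.map_comp]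
  · congr 2
    refine L'.hom_ext fun i => ?_
    rw [tuple_proj, proj, ← G.map_incl, ← G.map_comp]
    exact congrArg G.map (L.tuple_proj s i)
  · intro i
    rw [h i, change_mk]

end Free

/-- The finitary monad `T_L` on `Set` of a Lawvere theory `L`. -/
noncomputable def monad : Monad (Type u) where
  obj X := L.Free X
  map φ := ↾(Free.map φ)
  map_id X := by
    ext a
    exact Free.ind a fun _ _ _ => rfl
  map_comp φ ψ := by
    ext a
    exact Free.ind a fun _ _ _ => rfl
  η := { app := fun X => ↾Free.unit }
  μ :=
    { app := fun X => ↾Free.mult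
      naturality := fun X Y φ => by
        ext a
        exact Free.ind a fun n t b => (Free.map_act φ t b).symm }
  assoc X := by
    ext z
    exact Free.mult_assoc z
  left_unit X := by
    ext a
    exact Free.mult_unit a
  right_unit X := by
    ext a
    exact Free.mult_map_unit a

end LawvereTheory

/-- The functor `ι` from Lawvere theories to monads on `Set`. Morphisms of monads `T ⟶ T'` are
here natural transformations from `T` to `T'` that respect the monad structures. -/
noncomputable def ι : LawvereTheory.{u} ⥤ Monad (Type u) where
  obj L := L.monad
  map {L L'} G :=
    { app := fun X => ↾(LawvereTheory.Free.change (LawvereTheory.TheoryMap.toPreHom G))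
      naturality := fun X Y φ => by
        ext a
        exact LawvereTheory.Free.ind a fun _ _ _ => rfl
      app_η := fun X => by
        ext x
        exact congrArg (fun t => LawvereTheory.Free.mk one t fun _ => x)
          ((LawvereTheory.TheoryMap.toPreHom G).map_id one)
      app_μ := fun X => by
        ext z
        exact LawvereTheory.Free.change_mult _ z }
  map_id L := by
    apply MonadHom.ext'
    funext X
    ext a
    exact LawvereTheory.Free.ind a fun _ _ _ => rfl
  map_comp G H := by
    apply MonadHom.ext'
    funext X
    ext a
    exact LawvereTheory.Free.ind a fun _ _ _ => rfl

/-! ### The Eilenberg–Moore category of an indexed monad -/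

section EilenbergMoore

variable {B : Type w} [Category.{v} B] {C : Type u₁} [Category.{v₁} C]

/-- A `B`-indexed monad on `C`: monads `T_b` and monad morphisms `T_u : T_b ⟹ T_b'` for
`u : b ⟶ b'`, functorially in `u`. -/
abbrev IndexedMonad (B : Type w) [Category.{v} B] (C : Type u₁) [Category.{v₁} C] :=
  B ⥤ Monad C

/-- The objects of the Eilenberg–Moore category: pairs of `b` and a `T_b`-algebra. -/
structure EM (T : IndexedMonad B C) where
  base : B
  alg : (T.obj base).Algebra

namespace EM

variable {T : IndexedMonad B C}

/-- A morphism `(b, χ) ⟶ (b', χ')`: a pair of `u : b ⟶ b'` and a homomorphism of `T_b`-algebras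
from `χ` to `χ' ∘ T_u`, the restriction of `χ'` along `T_u`. -/
@[ext]
structure Hom (P Q : EM T) where
  base : P.base ⟶ Q.base
  hom : P.alg.A ⟶ Q.alg.A
  comm : (T.obj P.base).map hom ≫ (T.map base).app Q.alg.A ≫ Q.alg.a = P.alg.a ≫ hom

/-- The Eilenberg–Moore category of an indexed monad. -/
instance : Category (EM T) where
  Hom := Hom
  id P :=
    { base := 𝟙 P.base
      hom := 𝟙 P.alg.A
      comm := by
        rw [T.map_id]
        erw [(T.obj P.base).map_id, Category.id_comp, Category.id_comp, Category.comp_id] }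
  comp {P Q R} f g :=
    { base := f.base ≫ g.base
      hom := f.hom ≫ g.hom
      comm := by
        have h := (T.map f.base).naturality g.hom
        have e : (T.map (f.base ≫ g.base)).app R.alg.A =
            (T.map f.base).app R.alg.A ≫ (T.map g.base).app R.alg.A := by
          rw [T.map_comp]; rfl
        rw [e, (T.obj P.base).map_comp, Category.assoc, Category.assoc, reassoc_of% h, g.comm,
          ← Category.assoc P.alg.a, ← f.comm, Category.assoc, Category.assoc] }
  id_comp f := Hom.ext (Category.id_comp f.base) (Category.id_comp f.hom)
  comp_id f := Hom.ext (Category.comp_id f.base) (Category.comp_id f.hom)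
  assoc f g h := Hom.ext (Category.assoc f.base g.base h.base) (Category.assoc f.hom g.hom h.hom)

/-- The projection `π₀` from the Eilenberg–Moore category to `B`. -/
def π₀ (T : IndexedMonad B C) : EM T ⥤ B where
  obj P := P.base
  map f := Hom.base f

end EM

end EilenbergMoore

/-! ### The dependent product -/

section DepProd

variable {B : Type w} [Category.{v} B]

/-- The dependent product `∏_B 𝒳 = (Cat/B)(id_B, 𝒳)` of a category `𝒳` over `B`. Its objects are
the sections of the projection `𝒳.p : 𝒳.obj ⥤ B`, and its morphisms are the natural
transformations which `𝒳.p` sends to the identity of `id_B`. -/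
abbrev DepProd (𝒳 : BasedCategory.{v₁, u₁} B) :=
  BasedFunctor (BasedCategory.ofFunctor (𝟭 B)) 𝒳

/-- The action of `∏_B` on functors over `B`: composition. -/
def DepProd.map {𝒳 : BasedCategory.{v₁, u₁} B} {𝒴 : BasedCategory.{v₂, u₂} B}
    (F : BasedFunctor 𝒳 𝒴) : DepProd 𝒳 ⥤ DepProd 𝒴 where
  obj s := BasedFunctor.comp s F
  map ψ := BasedCategory.whiskerRight ψ F
  map_id _ := BasedNatTrans.homCategory.ext _ _ (Functor.whiskerRight_id' F.toFunctor)
  map_comp φ ψ := BasedNatTrans.homCategory.ext _ _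
    (Functor.whiskerRight_comp φ.toNatTrans ψ.toNatTrans F.toFunctor)

/-- The action of `∏_B` on natural transformations over `B`: whiskering. -/
def DepProd.map₂ {𝒳 : BasedCategory.{v₁, u₁} B} {𝒴 : BasedCategory.{v₂, u₂} B}
    {F G : BasedFunctor 𝒳 𝒴} (α : F ⟶ G) : DepProd.map F ⟶ DepProd.map G where
  app s := BasedCategory.whiskerLeft s α
  naturality _ _ ψ := BasedNatTrans.homCategory.ext _ _ (by
    ext b
    exact α.toNatTrans.naturality (ψ.toNatTrans.app b))

end DepProd

end IndexedLawvere

/-! In a Lawvere theory the object `n` is the `n`-fold power of `1`, so a product-preserving functor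
`M` is determined by the set `M 1` with the operations named by the morphisms `n ⟶ 1`. These
assemble into one structure map `T_L (M 1) → M 1`, `[n, t, x] ↦ M t x`, which is a `T_L`-algebra.
The equivalence applies this correspondence over each `b` and follows it along the morphisms of `B`.

The functor `toDepProd` sends a model `M` to the section `b ↦ (b, M_b 1)`. A transformation `M_b ⟹
M_b' ∘ L_u` is determined by its component at `1` (`hom_ext_of_atOne`), that component is a morphism
of the Eilenberg–Moore category over `u` (`atOne_str`), and every such morphism arises in this way
(`homOfCarrier`). This gives full faithfulness.

For essential surjectivity, an algebra on `A` yields the model `n ↦ A ^ n` (`power`), whose algebra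
is again `A` up to isomorphism (`algebraPowerIso`). A section `s` has the value `s b` over `b` only
up to a propositional equality, so it is replaced by an isomorphic section `strict s` with values in
the fibers; the algebras of the latter give the required model. -/

namespace IndexedLawvere

namespace LawvereTheory

/-- A morphism of `L`, with its source and target as objects of the category `L.Obj`. -/
abbrev arrow {L : LawvereTheory.{u}} {m n : Aleph0} (t : L.Hom m n) :
    (⟨m⟩ : L.Obj) ⟶ ⟨n⟩ := t

/-- In a Lawvere theory, the object `n` is the `n`-fold power of `1`. -/
noncomputable def isLimitPos (L : LawvereTheory.{u}) (n : Aleph0) :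
    IsLimit (Fan.mk (f := fun _ : Pos n => (⟨one⟩ : L.Obj)) (⟨n⟩ : L.Obj)
      (fun i => arrow (L.proj i))) :=
  haveI := L.preserves
  isLimitFanMkObjOfIsLimit L.I (fun _ : Pos n => op one) (fun i => (ofFun fun _ => i).op)
    (Cofan.IsColimit.op (isColimitPos n))

variable {L L' : LawvereTheory.{u}}

/-! ### The algebra of a model -/

theorem map_arrow_comp (M : L.Obj ⥤ Type u) {k m n : Aleph0} (s : L.Hom k m) (t : L.Hom m n) (y : M.obj ⟨k⟩) :
    M.map (arrow (L.comp s t)) y = M.map (arrow t) (M.map (arrow s) y) :=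
  congrArg (fun f : M.obj ⟨k⟩ ⟶ M.obj ⟨n⟩ => f y) (M.map_comp (arrow s) (arrow t))

theorem map_arrow_id (M : L.Obj ⥤ Type u) {n : Aleph0} (y : M.obj ⟨n⟩) : M.map (arrow (L.id n)) y = y :=
  congrArg (fun f : M.obj ⟨n⟩ ⟶ M.obj ⟨n⟩ => f y) (M.map_id (⟨n⟩ : L.Obj))

section Carrier

variable (M : L.Obj ⥤ Type u) [PreservesFiniteProducts M]

/-- `M` sends the product cone on `n` to a product cone of sets, and over a discrete diagram every
family is compatible. -/
theorem exists_pack {n : Aleph0} (x : Pos n → M.obj ⟨one⟩) :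
    ∃! y : M.obj ⟨n⟩, ∀ i, M.map (arrow (L.proj i)) y = x i := by
  have hl := isLimitFanMkObjOfIsLimit M _ _ (isLimitPos L n)
  have h := (Types.isLimit_iff _).1 ⟨hl⟩ (fun j => x j.as)
    (by rintro ⟨i⟩ ⟨j⟩ ⟨⟨f⟩⟩; cases (show i = j from f); simp)
  obtain ⟨y, hy, hu⟩ := h
  exact ⟨y, fun i => hy ⟨i⟩, fun z hz => hu z fun j => hz j.as⟩

/-- The element of `M n` with the given components in `M 1`. -/
noncomputable def pack {n : Aleph0} (x : Pos n → M.obj ⟨one⟩) : M.obj ⟨n⟩ :=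
  (exists_pack M x).choose

theorem map_proj_pack {n : Aleph0} (x : Pos n → M.obj ⟨one⟩) (i : Pos n) :
    M.map (arrow (L.proj i)) (pack M x) = x i :=
  (exists_pack M x).choose_spec.1 i

theorem eq_pack {n : Aleph0} {x : Pos n → M.obj ⟨one⟩} {y : M.obj ⟨n⟩}
    (h : ∀ i, M.map (arrow (L.proj i)) y = x i) : y = pack M x :=
  (exists_pack M x).choose_spec.2 y h

theorem pack_map_proj {n : Aleph0} (y : M.obj ⟨n⟩) :
    pack M (fun i => M.map (arrow (L.proj i)) y) = y :=
  (eq_pack M fun _ => rfl).symm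

theorem map_incl_pack {m n : Aleph0} (f : m ⟶ n) (x : Pos n → M.obj ⟨one⟩) :
    M.map (arrow (L.incl f)) (pack M x) = pack M fun i => x (f i) :=
  eq_pack M fun i => by rw [← map_arrow_comp, incl_proj, map_proj_pack]

theorem map_tuple {k n : Aleph0} (s : Pos n → L.Hom k one) (y : M.obj ⟨k⟩) :
    M.map (arrow (L.tuple s)) y = pack M fun i => M.map (arrow (s i)) y :=
  eq_pack M fun i => by rw [← map_arrow_comp, tuple_proj]

theorem pack_one (x : M.obj ⟨one⟩) : pack M (fun _ : Pos one => x) = x :=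
  (eq_pack M fun i => by rw [proj_one, map_arrow_id]).symm

/-- The structure map `T_L (M 1) → M 1`, `[n, t, x] ↦ M t x`. -/
noncomputable def str : L.Free (M.obj ⟨one⟩) → M.obj ⟨one⟩ :=
  Quot.lift (fun a => M.map (arrow a.opn) (pack M a.arg)) (by
    rintro _ _ ⟨f, t, x⟩
    -- The coend relation is respected because `M` of a reindexing acts on tuples by reindexing.
    exact (map_arrow_comp M _ _ _).trans (by rw [map_incl_pack]))

theorem str_mk {n : Aleph0} (t : L.Hom n one) (x : Pos n → M.obj ⟨one⟩) :
    str M (Free.mk n t x) = M.map (arrow t) (pack M x) := rfl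

theorem str_unit (x : M.obj ⟨one⟩) : str M (Free.unit x) = x := by
  rw [Free.unit, str_mk, pack_one, map_arrow_id]

/-- Over a common context `(k, y)` for the inner elements this is functoriality of `M` at `t ∘
⟨s_i⟩`, with `map_tuple` computing `M ⟨s_i⟩` coordinatewise. -/
theorem str_mult (z : L.Free (L.Free (M.obj ⟨one⟩))) :
    str M (Free.mult z) = str M (Free.map (str M) z) := by
  induction z using Free.ind with | h n t a
  obtain ⟨k, y, s, h⟩ := Free.exists_common a
  rw [Free.mult_mk, Free.act_eq t a s y h, str_mk, Free.map_mk, str_mk, map_arrow_comp, map_tuple]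
  simp only [h, str_mk]

/-- The `T_L`-algebra with underlying set `M 1` given by a model `M` of `L`. -/
noncomputable def algebra : L.monad.Algebra where
  A := M.obj ⟨one⟩
  a := ↾(str M)
  unit := by
    ext x
    exact str_unit M x
  assoc := by
    ext z
    exact str_mult M z

end Carrier

/-! ### Natural transformations of models -/

section Transformations

/-- The component at `1` of a natural transformation, as a function. -/
def atOne {M : L.Obj ⥤ Type u} {M' : L'.Obj ⥤ Type u} {G : L ⟶ L'} (μ : M ⟶ functorOf G ⋙ M') :
    M.obj ⟨one⟩ → M'.obj ⟨one⟩ :=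
  fun x => μ.app ⟨one⟩ x

/-- Naturality at the projections, which `G` preserves because it commutes with `incl`, forces every
component of `μ` to act coordinatewise by the one at `1`. -/
theorem app_pack {M : L.Obj ⥤ Type u} [PreservesFiniteProducts M] {M' : L'.Obj ⥤ Type u}
    [PreservesFiniteProducts M'] (G : L ⟶ L') (μ : M ⟶ functorOf G ⋙ M') {n : Aleph0}
    (x : Pos n → M.obj ⟨one⟩) :
    μ.app ⟨n⟩ (pack M x) = pack M' fun i => atOne μ (x i) :=
  eq_pack M' fun i => by
    have h := congrArg (fun f => f (pack M x)) (μ.naturality (arrow (L.proj i)))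
    have e : (functorOf G).map (arrow (L.proj i)) = arrow (L'.proj i) :=
      (TheoryMap.toPreHom G).map_incl _
    replace h : μ.app ⟨one⟩ (M.map (arrow (L.proj i)) (pack M x)) =
      M'.map ((functorOf G).map (arrow (L.proj i))) (μ.app ⟨n⟩ (pack M x)) := h
    rw [e, map_proj_pack] at h
    exact h.symm

variable {M : L.Obj ⥤ Type u} [PreservesFiniteProducts M] {M' : L'.Obj ⥤ Type u}
  [PreservesFiniteProducts M'] (G : L ⟶ L')

theorem atOne_str (μ : M ⟶ functorOf G ⋙ M') (z : L.Free (M.obj ⟨one⟩)) :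
    str M' (Free.change (TheoryMap.toPreHom G) (Free.map (atOne μ) z)) =
      atOne μ (str M z) := by
  induction z using Free.ind with | h n t x
  rw [Free.map_mk, Free.change_mk, str_mk, str_mk, ← app_pack G μ x]
  exact (congrArg (fun f => f (pack M x)) (μ.naturality (arrow t))).symm

theorem hom_ext_of_atOne {μ ν : M ⟶ functorOf G ⋙ M'} (h : atOne μ = atOne ν) :
    μ = ν := by
  ext ⟨n⟩ y
  rw [← pack_map_proj M y]
  exact (app_pack G μ _).trans (((app_pack G ν _).trans (by rw [h])).symm)

/-- The natural transformation whose component at `1` is a given homomorphism of algebras. -/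
noncomputable def homOfCarrier (f : M.obj ⟨one⟩ → M'.obj ⟨one⟩)
    (hf : ∀ z, str M' (Free.change (TheoryMap.toPreHom G) (Free.map f z)) = f (str M z)) :
    M ⟶ functorOf G ⋙ M' where
  app X := ↾fun y => pack M' fun i => f (M.map (arrow (L.proj i)) y)
  naturality X Y t := by
    obtain ⟨m⟩ := X
    obtain ⟨n⟩ := Y
    ext y
    refine (eq_pack M' fun i => ?_).symm
    -- Applied to the `i`-th component of `t` at the coordinates of `y`, the homomorphism condition
    -- is the `i`-th coordinate of the naturality square.
    have h := hf (Free.mk m (L.comp t (L.proj i)) fun j => M.map (arrow (L.proj j)) y)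
    rw [Free.map_mk, Free.change_mk, str_mk, str_mk, pack_map_proj, PreHom.map_comp,
      map_arrow_comp M, map_arrow_comp M', proj, PreHom.map_incl] at h
    exact h

theorem atOne_homOfCarrier (f : M.obj ⟨one⟩ → M'.obj ⟨one⟩)
    (hf : ∀ z, str M' (Free.change (TheoryMap.toPreHom G) (Free.map f z)) = f (str M z)) :
    atOne (homOfCarrier G f hf) = f := by
  funext y
  refine Eq.trans ?_ (pack_one M' (f y))
  refine congrArg (pack M') (funext fun i => congrArg f ?_)
  rw [proj_one, map_arrow_id]

end Transformations

/-! ### The model of an algebra -/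

section OfAlgebra

variable (χ : L.monad.Algebra)

/-- The structure map of a `T_L`-algebra. -/
def eval (z : L.Free χ.A) : χ.A := χ.a z

theorem eval_unit (x : χ.A) : eval χ (Free.unit x) = x :=
  congrArg (fun f : χ.A ⟶ χ.A => f x) χ.unit

theorem eval_mult (z : L.Free (L.Free χ.A)) : eval χ (Free.mult z) = eval χ (Free.map (eval χ) z) :=
  congrArg (fun f : L.monad.obj (L.monad.obj χ.A) ⟶ χ.A => f z) χ.assoc

theorem eval_proj {n : Aleph0} (x : Pos n → χ.A) (i : Pos n) :
    eval χ (Free.mk n (L.proj i) x) = x i := by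
  have h := Free.mk_incl (ofFun fun _ : Pos one => i) (L.id one) x
  rw [L.comp_id] at h
  exact (congrArg (eval χ) h).trans (eval_unit χ (x i))

/-- This is the associativity law of the algebra at `[n, t, ([k, proj_j ∘ s, x])_j]`: the tuple of
the components of `s` is `s` itself. It provides the functoriality of `power`. -/
theorem eval_comp {k n : Aleph0} (s : L.Hom k n) (t : L.Hom n one) (x : Pos k → χ.A) :
    eval χ (Free.mk k (L.comp s t) x) =
      eval χ (Free.mk n t fun j => eval χ (Free.mk k (L.comp s (L.proj j)) x)) := by
  have h := eval_mult χ (Free.mk n t fun j => Free.mk k (L.comp s (L.proj j)) x)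
  rw [Free.mult_mk, Free.act_eq t _ (fun j => L.comp s (L.proj j)) x fun _ => rfl, ← comp_tuple,
    tuple_proj_eq_id, L.comp_id] at h
  exact h

/-- The model `n ↦ A ^ n` of `L` given by a `T_L`-algebra with underlying set `A`. -/
def power : L.Obj ⥤ Type u where
  obj X := Pos X.arity → χ.A
  map {X Y} t := ↾fun x i => eval χ (Free.mk X.arity (L.comp t (L.proj i)) x)
  map_id X := by
    ext x i
    exact (congrArg (fun t => eval χ (Free.mk X.arity t x)) (L.id_comp _)).trans (eval_proj χ x i)
  map_comp {X Y Z} s t := by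
    ext x i
    exact (congrArg (fun t => eval χ (Free.mk X.arity t x)) (L.assoc s t _)).trans
      (eval_comp χ s _ x)

theorem power_map_incl {m n : Aleph0} (f : m ⟶ n) (x : Pos n → χ.A) :
    (power χ).map (arrow (L.incl f)) x = fun i => x (f i) := by
  funext i
  refine Eq.trans ?_ (eval_proj χ x (f i))
  exact congrArg (fun t => eval χ (Free.mk n t x)) (L.incl_proj f i)

/-- A finite product of objects of `L` is given by the sum of the arities. -/
theorem exists_isLimit_fan (L : LawvereTheory.{u}) {J : Type} [Finite J] (m : J → Aleph0) :
    ∃ (n : Aleph0) (e : Pos n ≃ Σ j, Pos (m j)),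
      Nonempty (IsLimit (Fan.mk (f := fun j => (⟨m j⟩ : L.Obj)) (⟨n⟩ : L.Obj) fun j =>
        arrow (L.incl (ofFun fun x => e.symm ⟨j, x⟩)))) := by
  obtain ⟨k, ⟨e⟩⟩ := Finite.exists_equiv_fin (Σ j, Pos (m j))
  let e' : Pos (FintypeCat.Skeleton.mk k) ≃ Σ j, Pos (m j) := Equiv.ulift.trans e.symm
  refine ⟨FintypeCat.Skeleton.mk k, e', ⟨Limits.Fan.IsLimit.mk _
    (fun s => L.tuple fun i => L.comp (s.proj (e' i).1) (L.proj (e' i).2)) ?_ ?_⟩⟩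
  · intro s j
    refine L.hom_ext fun x => (L.assoc _ _ _).trans ?_
    refine (congrArg (L.comp _) (L.incl_proj _ x)).trans ((L.tuple_proj _ _).trans ?_)
    change L.comp (s.proj (e' (e'.symm ⟨j, x⟩)).1) (L.proj (e' (e'.symm ⟨j, x⟩)).2) = _
    rw [Equiv.apply_symm_apply]
  · intro s t ht
    refine L.hom_ext fun i => ((L.tuple_proj _ i).trans ?_).symm
    rw [← ht]
    refine (L.assoc _ _ _).trans (congrArg (L.comp t) ((L.incl_proj _ _).trans ?_))
    exact congrArg L.proj (e'.symm_apply_apply i)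

/-- For each finite family it suffices to test one limit cone. The cone of `exists_isLimit_fan` has
legs in the image of `I`, on which `power χ` is mere reindexing, so its image is the bijection of `A
^ (Σ m_j)` with the product of the `A ^ m_j`. -/
instance : PreservesFiniteProducts (power χ) where
  preserves k := by
    have (X : Fin k → L.Obj) : PreservesLimit (Discrete.functor X) (power χ) := by
      obtain ⟨n, e, ⟨h⟩⟩ := exists_isLimit_fan L fun j => (X j).arity
      refine preservesLimit_of_preserves_limit_cone h ((isLimitMapConeFanMkEquiv _ _ _).symm ?_)
      refine Limits.Fan.IsLimit.mk _ (fun s => ↾fun x i => s.proj (e i).1 x (e i).2) ?_ ?_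
      · intro s j
        ext x
        refine (power_map_incl χ _ _).trans (funext fun i => ?_)
        change s.proj (e (e.symm ⟨j, i⟩)).1 x (e (e.symm ⟨j, i⟩)).2 = _
        rw [Equiv.apply_symm_apply]
        rfl
      · intro s t ht
        ext x
        refine funext fun i => ?_
        have h := congrFun (congrArg (fun f => f x) (ht (e i).1)) (e i).2
        refine Eq.trans ?_ h
        refine Eq.trans ?_ (congrFun (power_map_incl χ _ _) _).symm
        exact congrArg (t x) (e.symm_apply_apply i).symm
    exact preservesLimitsOfShape_of_discrete (power χ)

/-- The structure map of the model `n ↦ A ^ n` is that of the algebra `A`. -/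
theorem str_power (z : L.Free (Pos one → χ.A)) :
    str (power χ) z = fun _ => eval χ (Free.map (fun x => x ⟨(0 : Fin 1)⟩) z) := by
  induction z using Free.ind with | h n t x
  -- The carrier is `A ^ 1` rather than `A`, so packing evaluates each entry at the unique point.
  have h : pack (power χ) x = fun i => x i ⟨(0 : Fin 1)⟩ := (eq_pack _ fun i =>
    (power_map_incl χ _ _).trans (funext fun ⟨j⟩ =>
      congrArg (fun j => x i (ULift.up j)) (Subsingleton.elim (α := Fin 1) 0 j))).symm
  refine (str_mk (power χ) t x).trans
    ((congrArg ((power χ).map (arrow t)) h).trans (funext fun i => ?_))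
  refine congrArg (fun s => eval χ (Free.mk n s fun i => x i ⟨(0 : Fin 1)⟩)) ?_
  rw [proj_one, L.comp_id]

/-- The algebra of the model of an algebra. -/
noncomputable def algebraPowerIso : algebra (power χ) ≅ χ :=
  Monad.Algebra.isoMk
    { hom := ↾fun x : Pos one → χ.A => x ⟨(0 : Fin 1)⟩
      inv := ↾fun a _ => a
      hom_inv_id := by
        ext x
        funext ⟨j⟩
        exact congrArg (fun j => x (ULift.up j)) (Subsingleton.elim (α := Fin 1) 0 j)
      inv_hom_id := rfl }
    (by
      ext z
      exact (congrFun (str_power χ z) ⟨(0 : Fin 1)⟩).symm)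

variable {χ}

theorem eval_map_comp_proj {χ' : L'.monad.Algebra} (G : L ⟶ L') (f : χ.A → χ'.A)
    (hf : ∀ z, eval χ' (Free.change (TheoryMap.toPreHom G) (Free.map f z)) = f (eval χ z))
    {m n : Aleph0} (t : L.Hom m n) (x : Pos m → χ.A) (i : Pos n) :
    eval χ' (Free.mk m (L'.comp ((TheoryMap.toPreHom G).map t) (L'.proj i)) fun j => f (x j)) =
      f (eval χ (Free.mk m (L.comp t (L.proj i)) x)) := by
  rw [← hf, Free.map_mk, Free.change_mk, PreHom.map_comp, proj, proj, PreHom.map_incl]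

/-- The natural transformation of models given by a homomorphism of algebras. -/
def powerMap {χ' : L'.monad.Algebra} (G : L ⟶ L') (f : χ.A → χ'.A)
    (hf : ∀ z, eval χ' (Free.change (TheoryMap.toPreHom G) (Free.map f z)) = f (eval χ z)) :
    power χ ⟶ functorOf G ⋙ power χ' where
  app X := ↾fun x i => f (x i)
  naturality X Y t := by
    obtain ⟨m⟩ := X
    obtain ⟨n⟩ := Y
    ext x
    refine funext fun i : Pos n => ?_
    exact (eval_map_comp_proj G f hf t x i).symm

end OfAlgebra

end LawvereTheory
/-! ### Fibers of the Eilenberg–Moore category -/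

namespace EM

variable {B : Type w} [Category.{v} B] {C : Type u₁} [Category.{v₁} C] {T : IndexedMonad B C}

theorem hom_comp {P Q R : EM T} (f : P ⟶ Q) (g : Q ⟶ R) :
    Hom.hom (f ≫ g) = Hom.hom f ≫ Hom.hom g := rfl

/-- The inclusion of the category of `T_b`-algebras into the Eilenberg–Moore category. -/
def fiber (T : IndexedMonad B C) (b : B) : (T.obj b).Algebra ⥤ EM T where
  obj χ := ⟨b, χ⟩
  map {χ χ'} f :=
    { base := 𝟙 b
      hom := f.f
      comm := by
        rw [T.map_id]
        exact (congrArg _ (Category.id_comp _)).trans f.h }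
  map_id χ := rfl
  map_comp f g := Hom.ext (Category.id_comp _).symm rfl

/-- Transports an object along an equality of bases once and for all; the bases of the isomorphism
are recorded so that they can be cancelled later. -/
theorem exists_iso_fiber (P : EM T) {b : B} (h : P.base = b) :
    ∃ (χ : (T.obj b).Algebra) (e : P ≅ (fiber T b).obj χ),
      Hom.base e.hom = eqToHom h ∧ Hom.base e.inv = eqToHom h.symm := by
  subst h
  exact ⟨P.alg, Iso.refl P, rfl, rfl⟩

end EM

variable {B : Type w} [Category.{v} B]

/-! ### Replacing a section by one with values in the fibers -/

namespace DepProd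

variable {C : Type u₁} [Category.{v₁} C] {T : IndexedMonad B C}
  (s : DepProd (BasedCategory.ofFunctor (EM.π₀ T)))

/-- The underlying functor of a section. -/
def toEM : B ⥤ EM T := s.toFunctor

theorem base_obj (b : B) : ((toEM s).obj b).base = b :=
  Functor.congr_obj s.w b

theorem base_map {b b' : B} (f : b ⟶ b') :
    EM.Hom.base ((toEM s).map f) = eqToHom (base_obj s b) ≫ f ≫ eqToHom (base_obj s b').symm :=
  Functor.congr_hom s.w f

/-- The algebra which is the value of a section at `b`. -/
noncomputable def alg (b : B) : (T.obj b).Algebra :=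
  (EM.exists_iso_fiber ((toEM s).obj b) (base_obj s b)).choose

/-- The value of a section at `b`, as an object of the fiber over `b`. -/
noncomputable def iso (b : B) : (toEM s).obj b ≅ (EM.fiber T b).obj (alg s b) :=
  (EM.exists_iso_fiber ((toEM s).obj b) (base_obj s b)).choose_spec.choose

theorem base_iso_hom (b : B) : EM.Hom.base (iso s b).hom = eqToHom (base_obj s b) :=
  (EM.exists_iso_fiber ((toEM s).obj b) (base_obj s b)).choose_spec.choose_spec.1

theorem base_iso_inv (b : B) : EM.Hom.base (iso s b).inv = eqToHom (base_obj s b).symm :=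
  (EM.exists_iso_fiber ((toEM s).obj b) (base_obj s b)).choose_spec.choose_spec.2

/-- The section with values in the fibers which is isomorphic to a given section. -/
noncomputable def strict : B ⥤ EM T where
  obj b := (EM.fiber T b).obj (alg s b)
  map f := (iso s _).inv ≫ (toEM s).map f ≫ (iso s _).hom
  map_id b := by simp
  map_comp f g := by simp

/-- The comparison of a section with its replacement with values in the fibers. -/
noncomputable def strictIso : strict s ≅ toEM s :=
  NatIso.ofComponents (fun b => (iso s b).symm) (fun f => by simp [strict])

/-- All objects and morphisms are variables here, so that the equalities can be eliminated by
substitution. -/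
theorem conj_eqToHom {b b' c c' : B} (h : c = b) (h' : c' = b') {i : b ⟶ c} {m : c ⟶ c'}
    {j : c' ⟶ b'} {f : b ⟶ b'} (hi : i = eqToHom h.symm) (hj : j = eqToHom h')
    (hm : m = eqToHom h ≫ f ≫ eqToHom h'.symm) : i ≫ m ≫ j = f := by
  subst h h' hi hj hm
  simp

theorem base_strict_map {b b' : B} (f : b ⟶ b') : EM.Hom.base ((strict s).map f) = f :=
  conj_eqToHom (base_obj s b) (base_obj s b') (base_iso_inv s b) (base_iso_hom s b')
    (base_map s f)

end DepProd

/-! ### The comparison functor from models to sections -/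

namespace Model

open LawvereTheory

variable {L : B ⥤ LawvereTheory.{u}}

instance (M : Model L (Type u)) (b : B) : PreservesFiniteProducts (M.obj b) := M.preserves b

/-- The object of the Eilenberg–Moore category given by a model, at `b`. -/
noncomputable def emObj (M : Model L (Type u)) (b : B) : EM (L ⋙ ι) :=
  ⟨b, algebra (M.obj b)⟩

/-- A natural transformation between models of `L_b` and `L_b'` as a morphism of the
Eilenberg–Moore category. -/
noncomputable def emHom {M M' : Model L (Type u)} {b b' : B} (f : b ⟶ b')
    (μ : M.obj b ⟶ functorOf (L.map f) ⋙ M'.obj b') : emObj M b ⟶ emObj M' b' where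
  base := f
  hom := μ.app ⟨one⟩
  comm := by
    ext z
    exact atOne_str (L.map f) μ z

/-- The section of `π₀` given by a model. -/
noncomputable def toSection (M : Model L (Type u)) : B ⥤ EM (L ⋙ ι) where
  obj b := emObj M b
  map f := emHom f (M.map f)
  map_id b := EM.Hom.ext rfl (M.map_id b ⟨one⟩)
  map_comp f g := EM.Hom.ext rfl (M.map_comp f g ⟨one⟩)

/-- A vertical morphism lands in the restriction along `L.map (𝟙 b)`, which is the identity only
propositionally. Composing with `M'.map (𝟙 b)` supplies the right target, and its components are
identities. -/
theorem emHom_id_hom {M M' : Model L (Type u)} {b : B} (μ : M.obj b ⟶ M'.obj b) :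
    EM.Hom.hom (emHom (𝟙 b) (μ ≫ M'.map (𝟙 b))) = μ.app ⟨one⟩ :=
  (congrArg (μ.app ⟨one⟩ ≫ ·) (M'.map_id b ⟨one⟩)).trans (Category.comp_id _)

variable (L) in
/-- The functor from models to sections. -/
noncomputable def toDepProd :
    Model L (Type u) ⥤ DepProd (BasedCategory.ofFunctor (EM.π₀ (L ⋙ ι))) where
  obj M := { toFunctor := toSection M, w := rfl }
  map {M M'} φ :=
    { toNatTrans :=
        { app b := emHom (𝟙 b) (φ.app b ≫ M'.map (𝟙 b))
          naturality b b' f := by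
            refine EM.Hom.ext ((Category.comp_id f).trans (Category.id_comp f).symm) ?_
            refine (congrArg ((M.map f).app ⟨one⟩ ≫ ·) (emHom_id_hom (φ.app b'))).trans
              (Eq.trans ?_ (congrArg (· ≫ (M'.map f).app ⟨one⟩) (emHom_id_hom (φ.app b))).symm)
            exact (congrArg (fun α => α.app ⟨one⟩) (φ.comm f)).symm }
      isHomLift' := fun b =>
        IsHomLift.map (p := EM.π₀ (L ⋙ ι)) (emHom (𝟙 b) (φ.app b ≫ M'.map (𝟙 b))) }
  map_id M := by
    refine BasedNatTrans.homCategory.ext _ _ (NatTrans.ext (funext fun b => ?_))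
    exact EM.Hom.ext rfl (emHom_id_hom (𝟙 (M.obj b)))
  map_comp {M M' M''} φ ψ := by
    refine BasedNatTrans.homCategory.ext _ _ (NatTrans.ext (funext fun b => ?_))
    refine EM.Hom.ext (Category.id_comp (𝟙 b)).symm ?_
    refine (emHom_id_hom (φ.app b ≫ ψ.app b)).trans ?_
    exact (congrArg₂ (· ≫ ·) (emHom_id_hom (φ.app b)) (emHom_id_hom (ψ.app b))).symm

/-! ### Full faithfulness -/

/-- The value at `b` of a morphism of sections, as a morphism of the Eilenberg–Moore category. -/
def appEM {M M' : Model L (Type u)} (ψ : (toDepProd L).obj M ⟶ (toDepProd L).obj M') (b : B) :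
    emObj M b ⟶ emObj M' b :=
  ψ.toNatTrans.app b

theorem appEM_naturality {M M' : Model L (Type u)}
    (ψ : (toDepProd L).obj M ⟶ (toDepProd L).obj M') {b b' : B} (f : b ⟶ b') :
    emHom f (M.map f) ≫ appEM ψ b' = appEM ψ b ≫ emHom f (M'.map f) :=
  ψ.toNatTrans.naturality f

theorem base_appEM {M M' : Model L (Type u)}
    (ψ : (toDepProd L).obj M ⟶ (toDepProd L).obj M') (b : B) :
    EM.Hom.base (appEM ψ b) = 𝟙 b :=
  (@IsHomLift.eq_of_isHomLift _ _ _ _ (EM.π₀ (L ⋙ ι)) (emObj M b) (emObj M' b) (𝟙 b)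
    (appEM ψ b) (ψ.isHomLift' b)).symm

theorem appEM_map {M M' : Model L (Type u)} (φ : M ⟶ M') (b : B) :
    EM.Hom.hom (appEM ((toDepProd L).map φ) b) = (Model.Hom.app φ b).app ⟨one⟩ :=
  emHom_id_hom (Model.Hom.app φ b)

/-- The underlying function of the value at `b` of a morphism of sections. -/
def appFun {M M' : Model L (Type u)} (ψ : (toDepProd L).obj M ⟶ (toDepProd L).obj M') (b : B) :
    (M.obj b).obj ⟨one⟩ → (M'.obj b).obj ⟨one⟩ :=
  fun x => EM.Hom.hom (appEM ψ b) x

theorem str_appFun {M M' : Model L (Type u)} (ψ : (toDepProd L).obj M ⟶ (toDepProd L).obj M')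
    (b : B) (z : (L.obj b).Free ((M.obj b).obj ⟨one⟩)) :
    str (M'.obj b) (Free.change (TheoryMap.toPreHom (L.map (𝟙 b))) (Free.map (appFun ψ b) z)) =
      appFun ψ b (str (M.obj b) z) := by
  have h := EM.Hom.comm (appEM ψ b)
  rw [base_appEM] at h
  exact congrArg (fun f : (L.obj b).monad.obj ((M.obj b).obj ⟨one⟩) ⟶ (M'.obj b).obj ⟨one⟩ => f z) h

/-- As `functorOf` fixes objects definitionally, the equation needs no transport; it lets `appNat`
reuse the components of `homOfCarrier` with target `M'.obj b`. -/
theorem functorOf_map_id (b : B) {X Y : (L.obj b).Obj} (t : X ⟶ Y) :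
    (functorOf (L.map (𝟙 b))).map t = t := by
  rw [L.map_id]
  rfl

/-- The natural transformation given by the value at `b` of a morphism of sections. -/
noncomputable def appNat {M M' : Model L (Type u)}
    (ψ : (toDepProd L).obj M ⟶ (toDepProd L).obj M') (b : B) : M.obj b ⟶ M'.obj b where
  app X := (homOfCarrier (L.map (𝟙 b)) (appFun ψ b) (str_appFun ψ b)).app X
  naturality X Y t := by
    refine ((homOfCarrier (L.map (𝟙 b)) (appFun ψ b) (str_appFun ψ b)).naturality t).trans ?_
    exact congrArg (fun t => _ ≫ (M'.obj b).map t) (functorOf_map_id b t)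

theorem appNat_app_one {M M' : Model L (Type u)}
    (ψ : (toDepProd L).obj M ⟶ (toDepProd L).obj M') (b : B) :
    (appNat ψ b).app ⟨one⟩ = EM.Hom.hom (appEM ψ b) := by
  ext x
  exact congrFun (atOne_homOfCarrier (L.map (𝟙 b)) (appFun ψ b) (str_appFun ψ b)) x

instance : (toDepProd L).Faithful where
  map_injective {M M'} φ φ' h := by
    refine Model.Hom.ext (funext fun b => ?_)
    have e : (Model.Hom.app φ b).app ⟨one⟩ = (Model.Hom.app φ' b).app ⟨one⟩ := by
      rw [← appEM_map, ← appEM_map, h]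
    -- The composite has the shape required by `hom_ext_of_atOne`; the added factor is cancelled
    -- componentwise afterwards.
    have e' : Model.Hom.app φ b ≫ M'.map (𝟙 b) = Model.Hom.app φ' b ≫ M'.map (𝟙 b) :=
      hom_ext_of_atOne (L.map (𝟙 b)) (funext fun x =>
        congrArg (fun f => (M'.map (𝟙 b)).app ⟨one⟩ (f x)) e)
    ext X : 2
    have h : (Model.Hom.app φ b).app X ≫ (M'.map (𝟙 b)).app X =
      (Model.Hom.app φ' b).app X ≫ (M'.map (𝟙 b)).app X := congrArg (fun α => α.app X) e'
    rw [M'.map_id] at h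
    exact (Category.comp_id _).symm.trans (h.trans (Category.comp_id _))

instance : (toDepProd L).Full where
  map_surjective {M M'} ψ := by
    refine ⟨{ app := appNat ψ, comm := fun {b b'} f => ?_ }, ?_⟩
    -- Both sides are transformations into `M'_b' ∘ L_f`, so only the component at `1` matters, and
    -- there the equation is naturality of `ψ`.
    · refine hom_ext_of_atOne (L.map f) (funext fun x => ?_)
      have h := congrArg EM.Hom.hom (appEM_naturality ψ f)
      rw [EM.hom_comp, EM.hom_comp, ← appNat_app_one, ← appNat_app_one] at h
      exact congrArg (fun f => f x) h.symm
    · refine BasedNatTrans.homCategory.ext _ _ (NatTrans.ext (funext fun b => ?_))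
      exact EM.Hom.ext (base_appEM ψ b).symm
        ((emHom_id_hom (appNat ψ b)).trans (appNat_app_one ψ b))

/-! ### Essential surjectivity -/

section EssSurj

variable (s : DepProd (BasedCategory.ofFunctor (EM.π₀ (L ⋙ ι))))

/-- The value of a section at `b`, as an algebra of the monad of `L_b`. -/
noncomputable def algebraAt (b : B) : (L.obj b).monad.Algebra := DepProd.alg s b

/-- The underlying function of the value of a section at a morphism. -/
noncomputable def mapFun {b b' : B} (f : b ⟶ b') : (algebraAt s b).A → (algebraAt s b').A :=
  TypeCat.homEquiv (EM.Hom.hom ((DepProd.strict s).map f))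

theorem mapFun_id (b : B) (x : (algebraAt s b).A) : mapFun s (𝟙 b) x = x := by
  rw [mapFun, (DepProd.strict s).map_id]
  rfl

theorem mapFun_comp {b b' b'' : B} (f : b ⟶ b') (g : b' ⟶ b'') (x : (algebraAt s b).A) :
    mapFun s (f ≫ g) x = mapFun s g (mapFun s f x) := by
  rw [mapFun, (DepProd.strict s).map_comp]
  rfl

/-- Since `strict s` sends `f` to a morphism over exactly `f`, its algebra condition involves the
monad morphism of `L.map f`, as `powerMap` demands. -/
theorem eval_mapFun {b b' : B} (f : b ⟶ b') (z : (L.obj b).Free (algebraAt s b).A) :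
    eval (algebraAt s b') (Free.change (TheoryMap.toPreHom (L.map f)) (Free.map (mapFun s f) z)) =
      mapFun s f (eval (algebraAt s b) z) := by
  have h := EM.Hom.comm ((DepProd.strict s).map f)
  rw [DepProd.base_strict_map] at h
  exact congrArg
    (fun f : (L.obj b).monad.obj (algebraAt s b).A ⟶ (algebraAt s b').A => f z) h

/-- The model given by a section. -/
noncomputable def ofSection : Model L (Type u) where
  obj b := power (algebraAt s b)
  preserves b := inferInstance
  map f := powerMap (L.map f) (mapFun s f) (eval_mapFun s f)
  map_id b X := by
    ext x
    exact funext fun i => mapFun_id s b (x i)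
  map_comp f g X := by
    ext x
    exact funext fun i => mapFun_comp s f g (x i)

/-- The section of the model given by a section. -/
noncomputable def toSectionOfSectionIso : toSection (ofSection s) ≅ DepProd.strict s :=
  NatIso.ofComponents (fun b => (EM.fiber (L ⋙ ι) b).mapIso (algebraPowerIso (algebraAt s b)))
    -- Both composites lie over `f`; their underlying functions agree definitionally because
    -- `powerMap` acts coordinatewise.
    (fun f => EM.Hom.ext ((Category.comp_id _).trans
      ((DepProd.base_strict_map s f).symm.trans (Category.id_comp _).symm)) rfl)

instance : (toDepProd L).EssSurj where
  mem_essImage s := by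
    refine ⟨ofSection s,
      ⟨BasedNatIso.mkNatIso (toSectionOfSectionIso s ≪≫ DepProd.strictIso s) fun b => ?_⟩⟩
    -- The isomorphism is vertical: at `b` its base is an identity followed by the `eqToHom` of
    -- `base_obj s b`.
    refine IsHomLift.of_fac' (EM.π₀ (L ⋙ ι)) _ _ rfl (DepProd.base_obj s b) ?_
    exact congrArg (fun f : b ⟶ _ => 𝟙 b ≫ f)
      ((DepProd.base_iso_inv s b).trans (Category.id_comp _).symm)

end EssSurj

end Model
end IndexedLawvere

theorem mainTheorem5 {B : Type w} [Category.{v} B] (L : B ⥤ IndexedLawvere.LawvereTheory.{u}) :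
    Nonempty
      (IndexedLawvere.Model L (Type u) ≌
        IndexedLawvere.DepProd
          (BasedCategory.ofFunctor (IndexedLawvere.EM.π₀ (L ⋙ IndexedLawvere.ι)))) := by
  have : (IndexedLawvere.Model.toDepProd L).IsEquivalence := {}
  exact ⟨(IndexedLawvere.Model.toDepProd L).asEquivalence⟩
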